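/- Let $\mathcal{L}_s$ be the signature with binary operation symbols $\land,\lor,\cdot,\to$ and constants ${\rm f},{\rm e}$. An $\mathcal{L}_s$-lattice is an algebra $\mathbf{A}=\langle A,\land,\lor,\cdot,\to,{\rm f},{\rm e}\rangle$ such that $\langle A,\land,\lor\rangle$ is a lattice; it is complete if all meets and joins of subsets of $A$ exist. An $\mathrm{FL_e}$-algebra is an $\mathcal{L}_s$-lattice such that $\langle A,\cdot,{\rm e}\rangle$ is a commutative monoid and $a\cdot b\le c\iff a\le b\to c$ for all $a,b,c\in A$. Let $\mathcal{FL}_e$ be the class of all $\mathrm{FL_e}$-algebras, and let $\mathcal{FL}_{ew}$ and $\mathcal{FL}_{ec}$ be the classes of $\mathrm{FL_e}$-algebras satisfying ${\rm f}\le x\le{\rm e}$ and $x\le x\cdot x$, respectively. An m-$\mathcal{L}_s$-lattice is an $\mathcal{L}_s$-lattice $\mathbf{A}$ with unary operations $\Box,\Diamond$ satisfying $\Box x\land x=\Box x$, $\Diamond x\lor x=\Diamond x$, $\Box(x\land y)=\Box x\land\Box y$, $\Diamond(x\lor y)=\Diamond x\lor\Diamond y$, $\Box\Diamond x=\Diamond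 x$, $\Diamond\Box x=\Box x$, and $\Box(\star(\Box x_1,\dots,\Box x_n))=\star(\Box x_1,\dots,\Box x_n)$ for each $n$-ary symbol $\star$ of $\mathcal{L}_s$. For a class $\mathcal{K}$ of $\mathcal{L}_s$-lattices, $m\mathcal{K}$ is the class of m-$\mathcal{L}_s$-lattices $\langle\mathbf{A},\Box,\Diamond\rangle$ with $\mathbf{A}\in\mathcal{K}$, and $\overline{\mathcal{K}}$ is the class of complete members of $\mathcal{K}$. For a complete $\mathcal{L}_s$-lattice $\mathbf{B}$ and a set $W$, the full functional m-$\mathcal{L}_s$-lattice $\langle\mathbf{B}^W,\Box,\Diamond\rangle$ has the pointwise operations of $\mathbf{B}$ together with $(\Box g)(u)=\bigwedge_{v\in W}g(v)$ and $(\Diamond g)(u)=\bigvee_{v\in W}g(v)$. An m-$\mathcal{L}_s$-lattice is functional if it is isomorphic to a subalgebra of a full functional m-$\mathcal{L}_s$-lattice. One-variable formulas are built from atoms $P_i(x)$ ($i\in\mathbb{N}$) with the operation symbols of $\mathcal{L}_s$ and the quantifiers $\forall x,\exists x$. Given a complete $\mathcal{L}_s$-lattice $\mathbf{A}$, a non-empty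 set $S$ and maps $\mathcal{I}(P_i)\colon S\to A$, the value $[\![\varphi]\!]_u\in A$ of a one-variable formula $\varphi$ at $u\in S$ is defined by $[\![P_i(x)]\!]_u=\mathcal{I}(P_i)(u)$, by applying the operations of $\mathbf{A}$ for the symbols of $\mathcal{L}_s$, and by $[\![(\forall x)\varphi]\!]_u=\bigwedge_{v\in S}[\![\varphi]\!]_v$ and $[\![(\exists x)\varphi]\!]_u=\bigvee_{v\in S}[\![\varphi]\!]_v$. An equation $\varphi\approx\psi$ is valid in such a structure if $[\![\varphi]\!]_u=[\![\psi]\!]_u$ for all $u\in S$. For a class $\mathcal{K}$ of complete $\mathcal{L}_s$-lattices, $T\vDash^\forall_{\mathcal{K}}\varphi\approx\psi$ means that $\varphi\approx\psi$ is valid in every such structure over a member of $\mathcal{K}$ in which all equations of $T$ are valid. Modal formulas are built from variables $p_i$ ($i\in\mathbb{N}$) with the operation symbols of $\mathcal{L}_s$ and unary $\Box,\Diamond$. The translation $\varphi\mapsto\varphi^\ast$ from one-variable to modal formulas replaces $P_i(x)$ by $p_i$, $\forall x$ by $\Box$ and $\exists x$ by $\Diamond$, and $T^\ast=\{\alpha^\ast\approx\beta^\ast\mid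 \alpha\approx\beta\in T\}$. For a class $\mathcal{M}$ of m-$\mathcal{L}_s$-lattices, $\Sigma\vDash_{\mathcal{M}}\alpha\approx\beta$ means that $g(\alpha)=g(\beta)$ for every homomorphism $g$ from the algebra of modal formulas to a member of $\mathcal{M}$ such that $g(\alpha')=g(\beta')$ for all $\alpha'\approx\beta'\in\Sigma$. Theorem. Let $\mathcal{V}\in\{\mathcal{FL}_e,\mathcal{FL}_{ew},\mathcal{FL}_{ec}\}$. (a) Every member of $m\mathcal{V}$ is functional. (b) For any set $T\cup\{\varphi\approx\psi\}$ of equations between one-variable formulas, $$T\vDash^\forall_{\overline{\mathcal{V}}}\varphi\approx\psi\quad\Longleftrightarrow\quad T^\ast\vDash_{m\mathcal{V}}\varphi^\ast\approx\psi^\ast.$$ -/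

import Mathlib

universe u

namespace OneVar

/-! ## Lattices over the substructural signature -/

/-- An `L_s`-lattice: a lattice with binary operations `·` (written `*`) and `imp`, and constants
`fal` (the constant `f`) and `1` (the constant `e`). No laws relating the additional operations to
each other or to the order are imposed. The order is the lattice order `x ≤ y ↔ x ⊓ y = x`. -/
class LsLattice (A : Type u) extends Lattice A, Mul A, One A where
  /-- the binary operation `→` -/
  imp : A → A → A
  /-- the constant `f` -/
  fal : A

/-- A complete `L_s`-lattice: all meets and joins (of arbitrary subsets) exist. -/
class CompleteLsLattice (A : Type u) extends CompleteLattice A, LsLattice A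

/-- A class of `L_s`-lattices. -/
abbrev LsClass : Type (u + 1) := ∀ (A : Type u) [LsLattice A], Prop

/-- The class of `FL_e`-algebras: `(A, ·, e)` is a commutative monoid and `→` is the residuum
of `·`. -/
structure FLe (A : Type u) [LsLattice A] : Prop where
  mul_assoc : ∀ a b c : A, a * b * c = a * (b * c)
  mul_comm : ∀ a b : A, a * b = b * a
  one_mul : ∀ a : A, 1 * a = a
  residuation : ∀ a b c : A, a * b ≤ c ↔ a ≤ LsLattice.imp b c

/-- The class of `FL_ew`-algebras: `FL_e`-algebras satisfying `f ≤ x ≤ e`. -/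
structure FLew (A : Type u) [LsLattice A] : Prop extends FLe A where
  fal_le : ∀ a : A, LsLattice.fal ≤ a
  le_one : ∀ a : A, a ≤ 1

/-- The class of `FL_ec`-algebras: `FL_e`-algebras satisfying `x ≤ x · x`. -/
structure FLec (A : Type u) [LsLattice A] : Prop extends FLe A where
  le_mul_self : ∀ a : A, a ≤ a * a

/-! ## m-`L_s`-lattices -/

/-- An m-`L_s`-lattice: an `L_s`-lattice with unary operations `box` and `dia` such that the
lattice reduct is an m-lattice, and every operation of the signature, applied to boxed arguments,
yields a fixed point of `box`. -/
class MLsLattice (A : Type u) extends LsLattice A where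
  box : A → A
  dia : A → A
  box_inf_self : ∀ x : A, box x ⊓ x = box x
  dia_sup_self : ∀ x : A, dia x ⊔ x = dia x
  box_inf : ∀ x y : A, box (x ⊓ y) = box x ⊓ box y
  dia_sup : ∀ x y : A, dia (x ⊔ y) = dia x ⊔ dia y
  box_dia : ∀ x : A, box (dia x) = dia x
  dia_box : ∀ x : A, dia (box x) = box x
  box_inf_box : ∀ x y : A, box (box x ⊓ box y) = box x ⊓ box y
  box_sup_box : ∀ x y : A, box (box x ⊔ box y) = box x ⊔ box y
  box_mul_box : ∀ x y : A, box (box x * box y) = box x * box y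
  box_imp_box : ∀ x y : A, box (imp (box x) (box y)) = imp (box x) (box y)
  box_fal : box fal = fal
  box_one : box 1 = 1

/-- A homomorphism of m-`L_s`-lattices: it preserves all operations. -/
structure IsMHom {A : Type u} {B : Type u} [MLsLattice A] [MLsLattice B] (h : A → B) : Prop where
  map_inf : ∀ x y, h (x ⊓ y) = h x ⊓ h y
  map_sup : ∀ x y, h (x ⊔ y) = h x ⊔ h y
  map_mul : ∀ x y, h (x * y) = h x * h y
  map_imp : ∀ x y, h (LsLattice.imp x y) = LsLattice.imp (h x) (h y)
  map_fal : h LsLattice.fal = LsLattice.fal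
  map_one : h 1 = 1
  map_box : ∀ x, h (MLsLattice.box x) = MLsLattice.box (h x)
  map_dia : ∀ x, h (MLsLattice.dia x) = MLsLattice.dia (h x)

/-- The universe of the power `B^W`. -/
def FullFunctional (W B : Type u) : Type u := W → B

/-- The full functional m-`L_s`-lattice on `B^W`, for a complete `L_s`-lattice `B`: the operations
of `B` are taken pointwise, `box g` is constantly the meet of all values of `g`, and `dia g` is
constantly the join of all values of `g`. -/
instance (W B : Type u) [CompleteLsLattice B] : MLsLattice (FullFunctional W B) where
  toLattice := inferInstanceAs (Lattice (W → B))
  mul g h := fun w => g w * h w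
  one := fun _ => 1
  imp g h := fun w => LsLattice.imp (g w) (h w)
  fal := fun _ => LsLattice.fal
  box g := fun _ => ⨅ v, g v
  dia g := fun _ => ⨆ v, g v
  box_inf_self g := funext fun w => inf_eq_left.2 (iInf_le g w)
  dia_sup_self g := funext fun w => sup_eq_left.2 (le_iSup g w)
  box_inf _ _ := funext fun _ => iInf_inf_eq
  dia_sup _ _ := funext fun _ => iSup_sup_eq
  box_dia _ := funext fun w => haveI : Nonempty W := ⟨w⟩; ciInf_const
  dia_box _ := funext fun w => haveI : Nonempty W := ⟨w⟩; ciSup_const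
  box_inf_box _ _ := funext fun w => haveI : Nonempty W := ⟨w⟩; ciInf_const
  box_sup_box _ _ := funext fun w => haveI : Nonempty W := ⟨w⟩; ciInf_const
  box_mul_box _ _ := funext fun w => haveI : Nonempty W := ⟨w⟩; ciInf_const
  box_imp_box _ _ := funext fun w => haveI : Nonempty W := ⟨w⟩; ciInf_const
  box_fal := funext fun w => haveI : Nonempty W := ⟨w⟩; ciInf_const
  box_one := funext fun w => haveI : Nonempty W := ⟨w⟩; ciInf_const

/-- An m-`L_s`-lattice is functional if it is isomorphic to a subalgebra of a full functional
m-`L_s`-lattice, i.e., if it embeds into one. -/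
def IsFunctional (A : Type u) [MLsLattice A] : Prop :=
  ∃ (B : Type u) (_ : CompleteLsLattice B) (W : Type u)
    (h : A → FullFunctional W B), Function.Injective h ∧ IsMHom h

/-! ## One-variable first-order formulas and their semantics -/

/-- One-variable first-order formulas: the atoms are `P_i(x)` for the single variable `x`, and
`all`, `ex` are the quantifiers `∀x`, `∃x`. -/
inductive FOFm : Type
  | pred : ℕ → FOFm
  | inf : FOFm → FOFm → FOFm
  | sup : FOFm → FOFm → FOFm
  | mul : FOFm → FOFm → FOFm
  | imp : FOFm → FOFm → FOFm
  | fal : FOFm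
  | one : FOFm
  | all : FOFm → FOFm
  | ex : FOFm → FOFm

/-- The value `⟦φ⟧_u` at `u` in the structure with domain `S` and interpretation
`I i : S → A` of the unary predicate `P_i`. -/
def FOFm.val {A : Type u} [CompleteLsLattice A] {S : Type u} (I : ℕ → S → A) : FOFm → S → A
  | .pred i, u => I i u
  | .inf φ ψ, u => φ.val I u ⊓ ψ.val I u
  | .sup φ ψ, u => φ.val I u ⊔ ψ.val I u
  | .mul φ ψ, u => φ.val I u * ψ.val I u
  | .imp φ ψ, u => LsLattice.imp (φ.val I u) (ψ.val I u)
  | .fal, _ => LsLattice.fal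
  | .one, _ => 1
  | .all φ, _ => ⨅ v, φ.val I v
  | .ex φ, _ => ⨆ v, φ.val I v

/-- The equation `ε.1 ≈ ε.2` is valid in the structure given by `I`. -/
def FOValid {A : Type u} [CompleteLsLattice A] {S : Type u} (I : ℕ → S → A)
    (ε : FOFm × FOFm) : Prop :=
  ∀ u : S, ε.1.val I u = ε.2.val I u

/-- `ε` is a semantical consequence of `T` with respect to the complete members of the
class `K`: it is valid in every structure (with non-empty domain) over a complete member of `K` in
which all members of `T` are valid. -/
def FOConsequence (K : LsClass.{u}) (T : Set (FOFm × FOFm)) (ε : FOFm × FOFm) : Prop :=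
  ∀ (A : Type u) [CompleteLsLattice A], K A →
    ∀ (S : Type u) [Nonempty S] (I : ℕ → S → A), (∀ δ ∈ T, FOValid I δ) → FOValid I ε

/-! ## Modal formulas and equational consequence -/

/-- Propositional formulas with modal connectives `box`, `dia` and variables `p_i`. -/
inductive ModFm : Type
  | var : ℕ → ModFm
  | inf : ModFm → ModFm → ModFm
  | sup : ModFm → ModFm → ModFm
  | mul : ModFm → ModFm → ModFm
  | imp : ModFm → ModFm → ModFm
  | fal : ModFm
  | one : ModFm
  | box : ModFm → ModFm
  | dia : ModFm → ModFm

/-- The translation `φ ↦ φ^*`. -/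
def FOFm.star : FOFm → ModFm
  | .pred i => .var i
  | .inf φ ψ => .inf φ.star ψ.star
  | .sup φ ψ => .sup φ.star ψ.star
  | .mul φ ψ => .mul φ.star ψ.star
  | .imp φ ψ => .imp φ.star ψ.star
  | .fal => .fal
  | .one => .one
  | .all φ => .box φ.star
  | .ex φ => .dia φ.star

/-- The translation of equations. -/
def starEq (ε : FOFm × FOFm) : ModFm × ModFm := (ε.1.star, ε.2.star)

/-- An evaluation: a homomorphism from the algebra of modal formulas to `A`. -/
structure IsEvaluation {A : Type u} [MLsLattice A] (g : ModFm → A) : Prop where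
  map_inf : ∀ α β, g (.inf α β) = g α ⊓ g β
  map_sup : ∀ α β, g (.sup α β) = g α ⊔ g β
  map_mul : ∀ α β, g (.mul α β) = g α * g β
  map_imp : ∀ α β, g (.imp α β) = LsLattice.imp (g α) (g β)
  map_fal : g .fal = LsLattice.fal
  map_one : g .one = 1
  map_box : ∀ α, g (.box α) = MLsLattice.box (g α)
  map_dia : ∀ α, g (.dia α) = MLsLattice.dia (g α)

/-- Equational consequence in `mK`, the class of m-`L_s`-lattices whose `L_s`-lattice reduct
belongs to `K`. -/
def ModConsequence (K : LsClass.{u}) (Γ : Set (ModFm × ModFm)) (ε : ModFm × ModFm) : Prop :=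
  ∀ (A : Type u) [MLsLattice A], K A →
    ∀ g : ModFm → A, IsEvaluation g → (∀ δ ∈ Γ, g δ.1 = g δ.2) → g ε.1 = g ε.2

end OneVar

/-!
Let `A` be an m-`FL_e`-algebra. The fixed points of `box` (equivalently, of `dia`) form a subalgebra
`C`, and `box a`, `dia a` are the best approximations of `a` in `C` from below and above. If
infinitely many copies of `A` are glued along `C` inside one complete algebra `B` so that an
inequality between different copies holds only if it is witnessed by an element of `C`, then the
meet of all copies of `a` is `box a`, the join is `dia a`, and `a ↦ (copy of a)_i` is a functional
representation of `A`.

Such a `B` can be written down directly. A family `x : ι → A` with finitely many entries different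
from `1` stands for the formal product of its entries, `x i` being taken in the copy `i`. In the
copy `k` this product should lie below `b` iff each entry `x i` with `i ≠ k` can be replaced by an
element of `C` above it, and the best choice is `dia (x i)`; so the condition is
`x k * ∏_{i ≠ k} dia (x i) ≤ b`, that is, `fold k x ≤ b`. Since `dia (a * c) = dia a * c` for `c`
in `C`, this relation admits cut (`fold_mul_le`). Hence the lattice of sets of families closed
under the induced Galois connection is a complete `FL_e`-algebra `Amalgam A ι`, in which
`Amalgam.of j a = {x | fold j x ≤ a}` preserves all operations. A family involves only finitely many
copies, and testing against a copy it does not involve yields `Amalgam.iInf_of` and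
`Amalgam.iSup_of`. The laws of `FL_ew` and `FL_ec` pass from `A` to the amalgam.

The equivalence of the two consequence relations follows, because evaluations of modal formulas in
a full functional algebra `B^S` are the same as first-order structures over `B` with domain `S`
(`IsEvaluation.star_eq_val`).
-/

namespace OneVar

/-! ### The Galois algebra of a relation on a commutative monoid -/

section GaloisAlgebra

variable {M Q : Type u} [CommMonoid M] (s : M → Q → Prop)

/-- The complete lattice of Galois-closed subsets of a commutative monoid `M`, for a relation `s`
between `M` and `Q`. The attributes are pairs `(y, q)`, and `x` has the attribute `(y, q)` if
`s (x * y) q`; this choice makes the closure operator a nucleus. -/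
abbrev GaloisAlgebra : Type u := Concept M (M × Q) fun x p => s (x * p.1) p.2

namespace GaloisAlgebra

variable {s}

/-- The product of two closed sets: the closure of their elementwise product. -/
def mul (X Y : GaloisAlgebra s) : GaloisAlgebra s :=
  Concept.ofObjects _ {z | ∃ x ∈ X.extent, ∃ y ∈ Y.extent, z = x * y}

/-- The residual of two closed sets: the `z` that multiply `X` into `Y` (`mem_imp_iff`). It is given
by its attributes, which makes it closed by definition. -/
def imp (X Y : GaloisAlgebra s) : GaloisAlgebra s :=
  Concept.ofAttributes _ {p | ∃ x ∈ X.extent, ∃ q ∈ Y.intent, p = (x * q.1, q.2)}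

theorem mul_le_iff {X Y Z : GaloisAlgebra s} :
    mul X Y ≤ Z ↔ ∀ x ∈ X.extent, ∀ y ∈ Y.extent, x * y ∈ Z.extent := by
  rw [mul, Concept.ofObjects_le_iff]
  constructor
  · exact fun h x hx y hy => h ⟨x, hx, y, hy, rfl⟩
  · rintro h _ ⟨x, hx, y, hy, rfl⟩
    exact h x hx y hy

theorem mem_extent_iff {X : GaloisAlgebra s} {x : M} :
    x ∈ X.extent ↔ ∀ p ∈ X.intent, s (x * p.1) p.2 := by
  rw [← X.lowerPolar_intent]
  rfl

theorem mem_intent_iff {X : GaloisAlgebra s} {p : M × Q} :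
    p ∈ X.intent ↔ ∀ x ∈ X.extent, s (x * p.1) p.2 := by
  rw [← X.upperPolar_extent]
  rfl

theorem mem_imp_iff {X Y : GaloisAlgebra s} {z : M} :
    z ∈ (imp X Y).extent ↔ ∀ x ∈ X.extent, z * x ∈ Y.extent := by
  simp only [mem_extent_iff (X := Y)]
  constructor
  · intro h x hx q hq
    rw [mul_assoc]
    exact h ⟨x, hx, q, hq, rfl⟩
  · rintro h _ ⟨x, hx, q, hq, rfl⟩
    have := h x hx q hq
    rwa [mul_assoc] at this

theorem mul_le_iff_le_imp {X Y Z : GaloisAlgebra s} : mul X Y ≤ Z ↔ X ≤ imp Y Z := by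
  rw [mul_le_iff]
  exact forall₂_congr fun x _ => mem_imp_iff.symm

theorem mul_comm' (X Y : GaloisAlgebra s) : mul X Y = mul Y X := by
  refine eq_of_forall_ge_iff fun Z => ?_
  rw [mul_le_iff, mul_le_iff]
  constructor <;> intro h x hx y hy <;> rw [mul_comm] <;> exact h y hy x hx

variable (s) in
/-- The Galois algebra as a complete `L_s`-lattice in which the constant `f` is a given closed
set. -/
abbrev completeLsLattice (f : GaloisAlgebra s) : CompleteLsLattice (GaloisAlgebra s) where
  mul := mul
  one := Concept.ofObject _ 1
  imp := imp
  fal := f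

theorem fLe_completeLsLattice (f : GaloisAlgebra s) :
    @FLe (GaloisAlgebra s) (completeLsLattice s f).toLsLattice :=
  letI := completeLsLattice s f
  { mul_assoc := fun X Y Z => by
      change mul (mul X Y) Z = mul X (mul Y Z)
      refine eq_of_forall_ge_iff fun U => ?_
      rw [mul_comm' X (mul Y Z), mul_le_iff_le_imp (X := mul X Y),
        mul_le_iff_le_imp (X := mul Y Z), mul_le_iff, mul_le_iff]
      simp only [mem_imp_iff]
      constructor
      · intro h y hy z hz x hx
        rw [mul_comm, ← mul_assoc]
        exact h x hx y hy z hz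
      · intro h x hx y hy z hz
        rw [mul_assoc, mul_comm]
        exact h y hy z hz x hx
    mul_comm := mul_comm'
    one_mul := fun X => by
      change mul (Concept.ofObject _ 1) X = X
      refine eq_of_forall_ge_iff fun U => ?_
      rw [mul_le_iff_le_imp, Concept.ofObjects_le_iff, Set.singleton_subset_iff, mem_imp_iff]
      simp only [one_mul]
      rfl
    residuation := fun X Y Z => mul_le_iff_le_imp }

end GaloisAlgebra

end GaloisAlgebra

/-! ### The modalities of an m-`FL_e`-algebra -/

section Modalities

variable {A : Type u}

instance [LsLattice A] [h : Fact (FLe A)] : CommMonoid A where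
  mul_assoc := h.out.mul_assoc
  mul_comm := h.out.mul_comm
  one_mul := h.out.one_mul
  mul_one a := (h.out.mul_comm a 1).trans (h.out.one_mul a)

theorem mul_le_iff_le_imp [LsLattice A] [h : Fact (FLe A)] {a b c : A} :
    a * b ≤ c ↔ a ≤ LsLattice.imp b c :=
  h.out.residuation a b c

instance [LsLattice A] [Fact (FLe A)] : IsOrderedMonoid A where
  mul_le_mul_left a b hab c := by
    exact mul_le_iff_le_imp.2 (hab.trans (mul_le_iff_le_imp.1 le_rfl))

theorem sup_mul' [LsLattice A] [Fact (FLe A)] (a b c : A) : (a ⊔ b) * c = a * c ⊔ b * c := by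
  refine eq_of_forall_ge_iff fun d => ?_
  simp only [mul_le_iff_le_imp, sup_le_iff]

variable [MLsLattice A]

open MLsLattice

theorem box_le (a : A) : box a ≤ a := inf_eq_left.1 (box_inf_self a)

theorem le_dia (a : A) : a ≤ dia a := sup_eq_left.1 (dia_sup_self a)

theorem box_mono {a b : A} (h : a ≤ b) : box a ≤ box b := by
  rw [← inf_eq_left, ← box_inf, inf_eq_left.2 h]

theorem dia_mono {a b : A} (h : a ≤ b) : dia a ≤ dia b := by
  rw [← sup_eq_right, ← dia_sup, sup_eq_right.2 h]

theorem dia_dia (a : A) : dia (dia a) = dia a := by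
  rw [← box_dia a, dia_box]

theorem box_eq_self_iff {a : A} : box a = a ↔ dia a = a :=
  ⟨fun h => by rw [← h, dia_box], fun h => by rw [← h, box_dia]⟩

theorem dia_le_iff {a c : A} (hc : dia c = c) : dia a ≤ c ↔ a ≤ c :=
  ⟨(le_dia a).trans, fun h => (dia_mono h).trans hc.le⟩

theorem dia_one : dia (1 : A) = 1 := box_eq_self_iff.1 box_one

theorem dia_fal : dia (LsLattice.fal : A) = LsLattice.fal := box_eq_self_iff.1 box_fal

theorem dia_mul_of_dia_eq {a b : A} (ha : dia a = a) (hb : dia b = b) :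
    dia (a * b) = a * b := by
  rw [← box_eq_self_iff] at *
  rw [← ha, ← hb, box_mul_box]

theorem dia_imp_of_dia_eq {a b : A} (ha : dia a = a) (hb : dia b = b) :
    dia (LsLattice.imp a b) = LsLattice.imp a b := by
  rw [← box_eq_self_iff] at *
  rw [← ha, ← hb, box_imp_box]

variable [Fact (FLe A)]

theorem dia_mul_le (a b : A) : dia (a * b) ≤ dia a * dia b :=
  (dia_le_iff (dia_mul_of_dia_eq (dia_dia a) (dia_dia b))).2
    (mul_le_mul' (le_dia a) (le_dia b))

/-- By residuation, `◇` commutes with multiplication by a fixed point of the modalities. -/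
theorem dia_mul_right {a c : A} (hc : dia c = c) : dia (a * c) = dia a * c := by
  refine le_antisymm ((dia_mul_le a c).trans_eq (by rw [hc])) ?_
  rw [mul_le_iff_le_imp, dia_le_iff (dia_imp_of_dia_eq hc (dia_dia _)), ← mul_le_iff_le_imp]
  exact le_dia _

theorem dia_prod {ι : Type*} (t : Finset ι) (f : ι → A) (hf : ∀ i ∈ t, dia (f i) = f i) :
    dia (∏ i ∈ t, f i) = ∏ i ∈ t, f i :=
  Finset.prod_induction f (fun a => dia a = a) (fun _ _ => dia_mul_of_dia_eq) dia_one hf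

end Modalities

/-! ### Folding a family of copies into one of them -/

section Copies

open MLsLattice

variable {A ι : Type u} [MLsLattice A]

open Classical in
/-- How the copy `k` of the algebra sees an element `a` of the copy `i`: as `a` itself if `i = k`,
and as `◇ a`, its least upper bound in the shared subalgebra, otherwise. -/
noncomputable def view (k i : ι) (a : A) : A := if i = k then a else dia a

theorem view_self (k : ι) (a : A) : view k k a = a := if_pos rfl

theorem view_of_ne {k i : ι} (h : i ≠ k) (a : A) : view k i a = dia a := if_neg h

theorem view_mono (k i : ι) {a b : A} (h : a ≤ b) : view k i a ≤ view k i b := by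
  unfold view
  split_ifs
  exacts [h, dia_mono h]

theorem view_of_dia_eq (k i : ι) {a : A} (h : dia a = a) : view k i a = a := by
  unfold view
  split_ifs
  exacts [rfl, h]

theorem view_sup (k i : ι) (a b : A) : view k i (a ⊔ b) = view k i a ⊔ view k i b := by
  unfold view
  split_ifs
  exacts [rfl, dia_sup a b]

variable [Fact (FLe A)]

theorem view_mul_right (k i : ι) {a c : A} (hc : dia c = c) :
    view k i (a * c) = view k i a * c := by
  unfold view
  split_ifs
  exacts [rfl, dia_mul_right hc]

theorem view_mul_le (k i : ι) (a b : A) : view k i (a * b) ≤ dia a * view k i b := by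
  unfold view
  split_ifs
  exacts [mul_le_mul_left (le_dia a) b, dia_mul_le a b]

variable (A ι) in
/-- The weak direct power: families `ι → A` that are `1` at all but finitely many indices. The
family `x` stands for the formal product of elements `x i`, one from each copy of `A`. -/
def WeakPower : Submonoid (ι → A) where
  carrier := {x | {i | x i ≠ 1}.Finite}
  one_mem' := by simp
  mul_mem' {x y} hx hy := (Set.Finite.union hx hy).subset fun i hi => by
    by_contra h
    rw [Set.mem_union, not_or] at h
    exact hi (by rw [Pi.mul_apply, not_not.1 h.1, not_not.1 h.2, one_mul])

open Classical in
/-- The element `a` of the copy `j`. -/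
noncomputable def WeakPower.single (j : ι) (a : A) : WeakPower A ι :=
  ⟨Pi.mulSingle j a, (Set.finite_singleton j).subset fun i hi => by
    by_contra h
    exact hi (Pi.mulSingle_eq_of_ne (M := fun _ => A) h a)⟩

open WeakPower

theorem single_self (j : ι) (a : A) : (single j a).1 j = a := by
  classical
  exact Pi.mulSingle_eq_same (M := fun _ => A) j a

theorem single_of_ne {i j : ι} (h : i ≠ j) (a : A) : (single j a).1 i = 1 := by
  classical
  exact Pi.mulSingle_eq_of_ne (M := fun _ => A) h a

theorem single_one (j : ι) : (single j 1 : WeakPower A ι) = 1 := by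
  classical
  exact Subtype.ext (Pi.mulSingle_one (M := fun _ => A) j)

theorem single_mul (j : ι) (a b : A) : single j (a * b) = single j a * single j b := by
  classical
  exact Subtype.ext (Pi.mulSingle_mul (f := fun _ => A) j a b)

/-- The element of `A` that bounds the formal product `x` from the viewpoint of the copy `k`: the
`k`-th entry multiplied by `◇` of all the other entries. -/
noncomputable def fold (k : ι) (x : WeakPower A ι) : A := ∏ᶠ i, view k i (x.1 i)

theorem fold_eq {j : ι} {t : Finset ι} (k : ι) {x : WeakPower A ι} (hj : j ∉ t)
    (hx : ∀ i, i ≠ j → i ∉ t → x.1 i = 1) :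
    fold k x = view k j (x.1 j) * ∏ i ∈ t, view k i (x.1 i) := by
  classical
  rw [← Finset.prod_insert (f := fun i => view k i (x.1 i)) hj]
  refine finprod_eq_prod_of_mulSupport_subset _ fun i hi => ?_
  by_contra h
  rw [Finset.mem_coe, Finset.mem_insert, not_or] at h
  exact hi (by simp only [hx i h.1 h.2, view_of_dia_eq k i dia_one])

theorem exists_support (j : ι) (x y : WeakPower A ι) :
    ∃ t : Finset ι, j ∉ t ∧ (∀ i, i ≠ j → i ∉ t → x.1 i = 1) ∧
      ∀ i, i ≠ j → i ∉ t → y.1 i = 1 := by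
  classical
  refine ⟨(x.2.union y.2).toFinset.erase j, by simp, ?_, ?_⟩ <;>
  · intro i hi h
    by_contra hne
    exact h (Finset.mem_erase.2 ⟨hi, by simp [hne]⟩)

theorem fold_mono (k : ι) {x y : WeakPower A ι} (h : ∀ i, x.1 i ≤ y.1 i) :
    fold k x ≤ fold k y := by
  obtain ⟨t, hk, hx, hy⟩ := exists_support k x y
  rw [fold_eq k hk hx, fold_eq k hk hy]
  exact mul_le_mul' (view_mono k k (h k)) (Finset.prod_le_prod' fun i _ => view_mono k i (h i))

/-- Multiplying by an element of the copy `j` affects only the `j`-th factor of `fold`. -/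
theorem exists_fold_single_mul (k j : ι) (y : WeakPower A ι) :
    ∃ r : A, ∀ c, fold k (single j c * y) = view k j (c * y.1 j) * r := by
  obtain ⟨t, hj, hy, -⟩ := exists_support j y y
  refine ⟨∏ i ∈ t, view k i (y.1 i), fun c => ?_⟩
  have h : ∀ i, i ≠ j → (single j c * y).1 i = y.1 i := fun i hi => by
    change (single j c).1 i * y.1 i = y.1 i
    rw [single_of_ne hi, one_mul]
  rw [fold_eq k hj fun i hi ht => (h i hi).trans (hy i hi ht)]
  congr 1
  · change view k j ((single j c).1 j * y.1 j) = _
    rw [single_self]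
  · exact Finset.prod_congr rfl fun i hi => by rw [h i (ne_of_mem_of_not_mem hi hj)]

theorem fold_single_mul (k : ι) (c : A) (y : WeakPower A ι) :
    fold k (single k c * y) = c * fold k y := by
  obtain ⟨r, hr⟩ := exists_fold_single_mul k k y
  have h1 := hr 1
  rw [single_one, one_mul, one_mul, view_self] at h1
  rw [hr, h1, view_self, mul_assoc]

theorem fold_one (k : ι) : fold k (1 : WeakPower A ι) = 1 :=
  finprod_eq_one_of_forall_eq_one fun i => view_of_dia_eq k i dia_one

theorem fold_single (k j : ι) (c : A) : fold k (single j c) = view k j c := by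
  obtain ⟨r, hr⟩ := exists_fold_single_mul k j (1 : WeakPower A ι)
  have h1 : (1 : WeakPower A ι).1 j = 1 := rfl
  have h := hr 1
  rw [single_one, one_mul, fold_one, h1, one_mul, view_of_dia_eq k j dia_one, one_mul] at h
  have h2 := hr c
  rwa [← h, mul_one, mul_one, h1, mul_one] at h2

theorem dia_fold {j : ι} {x : WeakPower A ι} (hx : x.1 j = 1) : dia (fold j x) = fold j x := by
  obtain ⟨t, hj, ht, -⟩ := exists_support j x x
  rw [fold_eq j hj ht, hx, view_self, one_mul]
  refine dia_prod _ _ fun i hi => ?_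
  rw [view_of_ne (ne_of_mem_of_not_mem hi hj), dia_dia]

/-- The cut property: replacing the formal product `x` by its bound in any copy `j` can only
increase the bound of a larger product. -/
theorem fold_mul_le (k j : ι) (x y : WeakPower A ι) :
    fold k (x * y) ≤ fold k (single j (fold j x) * y) := by
  obtain ⟨t, hj, hx, hy⟩ := exists_support j x y
  have hxy : ∀ i, i ≠ j → i ∉ t → (x * y).1 i = 1 := fun i hi ht => by
    change x.1 i * y.1 i = 1
    rw [hx i hi ht, hy i hi ht, one_mul]
  have hs : ∀ i, i ≠ j → (single j (fold j x) * y).1 i = y.1 i := fun i hi => by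
    change (single j (fold j x)).1 i * y.1 i = y.1 i
    rw [single_of_ne hi, one_mul]
  have hne : ∀ i ∈ t, i ≠ j := fun i hi => ne_of_mem_of_not_mem hi hj
  have hd : dia (∏ i ∈ t, view j i (x.1 i)) = ∏ i ∈ t, view j i (x.1 i) :=
    dia_prod _ _ fun i hi => by rw [view_of_ne (hne i hi), dia_dia]
  have hjj : (single j (fold j x) * y).1 j
      = x.1 j * y.1 j * ∏ i ∈ t, view j i (x.1 i) := by
    change (single j (fold j x)).1 j * y.1 j = _
    rw [single_self, fold_eq j hj hx, view_self, mul_right_comm]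
  -- The bound of `x` in the copy `j` is `x j` times a fixed point of `◇`, which passes through
  -- `view k j`; so only the factors at the indices other than `j` have to be compared.
  rw [fold_eq k hj hxy, fold_eq k hj fun i hi ht => (hs i hi).trans (hy i hi ht), hjj,
    view_mul_right k j hd, mul_assoc, ← Finset.prod_mul_distrib]
  refine mul_le_mul_right (Finset.prod_le_prod' fun i hi => ?_) _
  rw [hs i (hne i hi), view_of_ne (hne i hi)]
  exact view_mul_le k i _ _

theorem fold_le_iff_of_dia_eq (j k : ι) {x : WeakPower A ι} {c : A} (hc : dia c = c) :
    fold j x ≤ c ↔ fold k x ≤ c := by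
  have key : ∀ j k : ι, fold j x ≤ c → fold k x ≤ c := fun j k h => by
    have hcut := fold_mul_le k j x 1
    rw [mul_one, mul_one, fold_single] at hcut
    exact hcut.trans ((view_mono k j h).trans_eq (view_of_dia_eq k j hc))
  exact ⟨key j k, key k j⟩

/-! ### The amalgam of the copies -/

variable (A ι) in
/-- The Galois algebra of the relation `fold k x ≤ b`, which contains a copy of `A` for each index
in `ι`, any two of them meeting in the subalgebra of fixed points of the modalities. -/
abbrev Amalgam : Type u :=
  GaloisAlgebra fun (x : WeakPower A ι) (q : ι × A) => fold q.1 x ≤ q.2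

/-- The embedding of `A` as the `j`-th copy. -/
noncomputable def Amalgam.of (j : ι) (a : A) : Amalgam A ι :=
  Concept.ofAttribute _ (1, (j, a))

namespace Amalgam

theorem mem_extent_of {j : ι} {a : A} {x : WeakPower A ι} :
    x ∈ (of j a).extent ↔ fold j x ≤ a := by
  simp [of]

theorem single_mem_extent_of (j : ι) (a : A) : single j a ∈ (of j a).extent := by
  rw [mem_extent_of, fold_single, view_self]

theorem mem_intent_of {j : ι} {a : A} {p : WeakPower A ι × (ι × A)} :
    p ∈ (of j a).intent ↔ fold p.2.1 (single j a * p.1) ≤ p.2.2 := by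
  rw [GaloisAlgebra.mem_intent_iff]
  refine ⟨fun h => h _ (single_mem_extent_of j a), fun h x hx => ?_⟩
  refine (fold_mul_le p.2.1 j x p.1).trans (le_trans (fold_mono _ fun i => ?_) h)
  change (single j (fold j x)).1 i * p.1.1 i ≤ (single j a).1 i * p.1.1 i
  refine mul_le_mul_left ?_ _
  obtain rfl | hi := eq_or_ne i j
  · rw [single_self, single_self]
    exact mem_extent_of.1 hx
  · rw [single_of_ne hi, single_of_ne hi]

theorem of_eq_ofObject (j : ι) (a : A) : of j a = Concept.ofObject _ (single j a) := by
  refine Concept.ext' (Set.ext fun p => mem_intent_of.trans ?_)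
  simp

theorem of_le_iff {j : ι} {a : A} {X : Amalgam A ι} : of j a ≤ X ↔ single j a ∈ X.extent := by
  rw [of_eq_ofObject, Concept.ofObjects_le_iff, Set.singleton_subset_iff]

theorem of_injective (j : ι) : Function.Injective (of j : A → Amalgam A ι) := by
  have key : ∀ a b : A, of (ι := ι) j a = of j b → a ≤ b := fun a b h => by
    have := of_le_iff.1 h.le
    rwa [mem_extent_of, fold_single, view_self] at this
  exact fun a b h => le_antisymm (key a b h) (key b a h.symm)

/-- The copies of `A` agree on the fixed points of the modalities. -/
theorem of_eq_of_dia_eq (j k : ι) {c : A} (hc : dia c = c) : of j c = of k c :=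
  Concept.ext (Set.ext fun _ => by
    rw [mem_extent_of, mem_extent_of, fold_le_iff_of_dia_eq j k hc])

theorem of_inf (j : ι) (a b : A) : of j (a ⊓ b) = of j a ⊓ of j b := by
  refine Concept.ext (Set.ext fun x => ?_)
  rw [Concept.extent_inf, Set.mem_inter_iff]
  simp only [mem_extent_of, le_inf_iff]

theorem of_sup (j : ι) (a b : A) : of j (a ⊔ b) = of j a ⊔ of j b := by
  refine Concept.ext' (Set.ext fun p => ?_)
  rw [Concept.intent_sup, Set.mem_inter_iff]
  obtain ⟨r, hr⟩ := exists_fold_single_mul p.2.1 j p.1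
  simp only [mem_intent_of, hr, sup_mul', view_sup, sup_le_iff]

theorem of_mul (j : ι) (a b : A) : of j (a * b) = GaloisAlgebra.mul (of j a) (of j b) := by
  refine le_antisymm ?_ ?_
  · rw [of_le_iff, single_mul]
    exact GaloisAlgebra.mul_le_iff.1 le_rfl _ (single_mem_extent_of j a) _
      (single_mem_extent_of j b)
  · refine GaloisAlgebra.mul_le_iff.2 fun x hx y hy => ?_
    rw [mem_extent_of] at *
    refine (fold_mul_le j j x y).trans ?_
    rw [fold_single_mul]
    exact mul_le_mul' hx hy

theorem of_imp (j : ι) (a b : A) :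
    of j (LsLattice.imp a b) = GaloisAlgebra.imp (of j a) (of j b) := by
  refine Concept.ext (Set.ext fun z => ?_)
  rw [GaloisAlgebra.mem_imp_iff, mem_extent_of, ← mul_le_iff_le_imp]
  simp only [mem_extent_of]
  refine ⟨fun h x hx => ?_, fun h => ?_⟩
  · rw [mul_comm]
    refine (fold_mul_le j j x z).trans ?_
    rw [fold_single_mul, mul_comm]
    exact (mul_le_mul_right hx _).trans h
  · have := h _ (mem_extent_of.1 (single_mem_extent_of j a))
    rwa [mul_comm, fold_single_mul, mul_comm] at this

theorem of_one (j : ι) : of j (1 : A) = Concept.ofObject _ (1 : WeakPower A ι) := by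
  rw [of_eq_ofObject, single_one]

/-- Every element of `WeakPower A ι` misses some copy, so what it bounds in all copies it bounds
through the shared subalgebra. -/
theorem iInf_of [Infinite ι] (j : ι) (a : A) : ⨅ i, of i a = of j (box a) := by
  have hb : dia (box a) = box a := dia_box a
  refine le_antisymm (fun x hx => ?_) (le_iInf fun i => ?_)
  · obtain ⟨m, hm⟩ := x.2.exists_notMem
    have hm1 : x.1 m = 1 := not_not.1 hm
    rw [of_eq_of_dia_eq j m hb, mem_extent_of]
    rw [Concept.extent_iInf, Set.mem_iInter] at hx
    have h := box_mono (mem_extent_of.1 (hx m))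
    rwa [box_eq_self_iff.2 (dia_fold hm1)] at h
  · rw [of_eq_of_dia_eq j i hb, of_le_iff, mem_extent_of, fold_single, view_self]
    exact box_le a

theorem iSup_of [Infinite ι] (j : ι) (a : A) : ⨆ i, of i a = of j (dia a) := by
  refine le_antisymm (iSup_le fun i => ?_) ?_
  · rw [of_eq_of_dia_eq j i (dia_dia a), of_le_iff, mem_extent_of, fold_single, view_self]
    exact le_dia a
  · rw [← Concept.intent_subset_intent_iff, Concept.intent_iSup]
    rintro ⟨y, k, b⟩ hp
    -- A copy `m` that is neither `k` nor used by `y` sees `a` and `◇ a` in the same way.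
    obtain ⟨m, hm⟩ := (y.2.union (Set.finite_singleton k)).exists_notMem
    rw [Set.mem_union, not_or] at hm
    have hm1 : y.1 m = 1 := not_not.1 hm.1
    have hmk : m ≠ k := hm.2
    have h := mem_intent_of.1 (Set.mem_iInter.1 hp m)
    rw [of_eq_of_dia_eq j m (dia_dia a), mem_intent_of]
    obtain ⟨r, hr⟩ := exists_fold_single_mul k m y
    simp only [hr, hm1, mul_one, view_of_ne hmk, dia_dia] at h ⊢
    exact h

/-- The amalgam as a complete `L_s`-lattice; its constant `f` is that of the copies of `A`, taken
in the copy `j` (which does not matter). -/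
noncomputable abbrev completeLsLattice (j : ι) : CompleteLsLattice (Amalgam A ι) :=
  GaloisAlgebra.completeLsLattice _ (of j LsLattice.fal)

theorem fLe (j : ι) : @FLe (Amalgam A ι) (completeLsLattice j).toLsLattice :=
  GaloisAlgebra.fLe_completeLsLattice _

theorem fLew (hA : FLew A) (j : ι) : @FLew (Amalgam A ι) (completeLsLattice j).toLsLattice :=
  letI : CompleteLsLattice (Amalgam A ι) := completeLsLattice j
  { fLe j with
    fal_le := fun X => by
      change of j LsLattice.fal ≤ X
      intro x hx
      refine GaloisAlgebra.mem_extent_iff.2 fun p _ => ?_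
      have h := (fold_le_iff_of_dia_eq j p.2.1 dia_fal).1 (mem_extent_of.1 hx)
      refine (fold_mul_le p.2.1 p.2.1 x p.1).trans ?_
      rw [fold_single_mul]
      exact (mul_le_of_le_one_right' (hA.le_one _)).trans (h.trans (hA.fal_le _))
    le_one := fun X => by
      change X ≤ Concept.ofObject _ 1
      rw [← of_one j]
      exact fun x _ => mem_extent_of.2 (hA.le_one _) }

theorem fLec (hA : FLec A) (j : ι) : @FLec (Amalgam A ι) (completeLsLattice j).toLsLattice :=
  letI : CompleteLsLattice (Amalgam A ι) := completeLsLattice j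
  { fLe j with
    le_mul_self := fun X => by
      change X ≤ GaloisAlgebra.mul X X
      intro x hx
      refine GaloisAlgebra.mem_extent_iff.2 fun p hp => ?_
      have h := GaloisAlgebra.mem_intent_iff.1 hp (x * x)
        (GaloisAlgebra.mul_le_iff.1 le_rfl x hx x hx)
      exact (fold_mono _ fun i => mul_le_mul_left (hA.le_mul_self (x.1 i)) _).trans h }

variable (ι) in
/-- The representation of an element by the family of its copies. -/
noncomputable def family (a : A) : FullFunctional ι (Amalgam A ι) := fun i => of i a

theorem isMHom_family [Infinite ι] (j : ι) :
    letI : CompleteLsLattice (Amalgam A ι) := completeLsLattice j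
    IsMHom (family ι : A → FullFunctional ι (Amalgam A ι)) :=
  letI : CompleteLsLattice (Amalgam A ι) := completeLsLattice j
  { map_inf := fun a b => funext fun i => of_inf i a b
    map_sup := fun a b => funext fun i => of_sup i a b
    map_mul := fun a b => funext fun i => of_mul i a b
    map_imp := fun a b => funext fun i => of_imp i a b
    map_fal := funext fun i => of_eq_of_dia_eq i j dia_fal
    map_one := funext fun i => of_one i
    map_box := fun a => funext fun i => (iInf_of i a).symm
    map_dia := fun a => funext fun i => (iSup_of i a).symm }

end Amalgam

end Copies

/-! ### Functional representation and the completeness of the translation -/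

/-- Every m-algebra over one of the three classes has a functional representation over a complete
algebra in the same class. -/
theorem exists_representation {V : LsClass.{u}}
    (hV : V = @FLe ∨ V = @FLew ∨ V = @FLec) (A : Type u) [MLsLattice A] (hA : V A) :
    ∃ (B : Type u) (_ : CompleteLsLattice B) (W : Type u) (h : A → FullFunctional W B),
      V B ∧ Nonempty W ∧ Function.Injective h ∧ IsMHom h := by
  have hF : FLe A := by
    obtain rfl | rfl | rfl := hV
    exacts [hA, hA.toFLe, hA.toFLe]
  have : Fact (FLe A) := ⟨hF⟩
  let j : ULift.{u} ℕ := ⟨0⟩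
  refine ⟨Amalgam A (ULift.{u} ℕ), Amalgam.completeLsLattice j, ULift.{u} ℕ, Amalgam.family _,
    ?_, ⟨j⟩, fun a b h => Amalgam.of_injective j (congrFun h j), Amalgam.isMHom_family j⟩
  obtain rfl | rfl | rfl := hV
  exacts [Amalgam.fLe j, Amalgam.fLew hA j, Amalgam.fLec hA j]

theorem fullFunctional_mem {V : LsClass.{u}} (hV : V = @FLe ∨ V = @FLew ∨ V = @FLec)
    (W B : Type u) [CompleteLsLattice B] (hB : V B) : V (FullFunctional W B) := by
  have hFLe : FLe B → FLe (FullFunctional W B) := fun h =>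
    { mul_assoc := fun _ _ _ => funext fun _ => h.mul_assoc _ _ _
      mul_comm := fun _ _ => funext fun _ => h.mul_comm _ _
      one_mul := fun _ => funext fun _ => h.one_mul _
      residuation := fun _ _ _ => forall_congr' fun _ => h.residuation _ _ _ }
  obtain rfl | rfl | rfl := hV
  · exact hFLe hB
  · exact { hFLe hB.toFLe with
      fal_le := fun _ _ => hB.fal_le _
      le_one := fun _ _ => hB.le_one _ }
  · exact { hFLe hB.toFLe with le_mul_self := fun _ _ => hB.le_mul_self _ }

/-- The value of a modal formula in an m-`L_s`-lattice under an assignment of its variables. -/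
def ModFm.eval {A : Type u} [MLsLattice A] (v : ℕ → A) : ModFm → A
  | .var i => v i
  | .inf α β => α.eval v ⊓ β.eval v
  | .sup α β => α.eval v ⊔ β.eval v
  | .mul α β => α.eval v * β.eval v
  | .imp α β => LsLattice.imp (α.eval v) (β.eval v)
  | .fal => LsLattice.fal
  | .one => 1
  | .box α => MLsLattice.box (α.eval v)
  | .dia α => MLsLattice.dia (α.eval v)

theorem ModFm.isEvaluation_eval {A : Type u} [MLsLattice A] (v : ℕ → A) :
    IsEvaluation (ModFm.eval v) := by
  constructor <;> intros <;> rfl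

theorem IsMHom.comp_isEvaluation {A B : Type u} [MLsLattice A] [MLsLattice B] {h : A → B}
    (hh : IsMHom h) {g : ModFm → A} (hg : IsEvaluation g) : IsEvaluation fun α => h (g α) where
  map_inf α β := by rw [hg.map_inf, hh.map_inf]
  map_sup α β := by rw [hg.map_sup, hh.map_sup]
  map_mul α β := by rw [hg.map_mul, hh.map_mul]
  map_imp α β := by rw [hg.map_imp, hh.map_imp]
  map_fal := by rw [hg.map_fal, hh.map_fal]
  map_one := by rw [hg.map_one, hh.map_one]
  map_box α := by rw [hg.map_box, hh.map_box]
  map_dia α := by rw [hg.map_dia, hh.map_dia]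

/-- Evaluations in the full functional algebra over `B` with index set `S` are the first-order
structures over `B` with domain `S`. -/
theorem IsEvaluation.star_eq_val {S B : Type u} [CompleteLsLattice B]
    {g : ModFm → FullFunctional S B} (hg : IsEvaluation g) (φ : FOFm) :
    g φ.star = φ.val fun i => g (.var i) := by
  induction φ with
  | pred i => rfl
  | inf φ ψ hφ hψ => rw [FOFm.star, hg.map_inf, hφ, hψ]; rfl
  | sup φ ψ hφ hψ => rw [FOFm.star, hg.map_sup, hφ, hψ]; rfl
  | mul φ ψ hφ hψ => rw [FOFm.star, hg.map_mul, hφ, hψ]; rfl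
  | imp φ ψ hφ hψ => rw [FOFm.star, hg.map_imp, hφ, hψ]; rfl
  | fal => exact hg.map_fal
  | one => exact hg.map_one
  | all φ hφ => rw [FOFm.star, hg.map_box, hφ]; rfl
  | ex φ hφ => rw [FOFm.star, hg.map_dia, hφ]; rfl

theorem IsEvaluation.foValid_iff {S B : Type u} [CompleteLsLattice B]
    {g : ModFm → FullFunctional S B} (hg : IsEvaluation g) (ε : FOFm × FOFm) :
    FOValid (fun i => g (.var i)) ε ↔ g (starEq ε).1 = g (starEq ε).2 := by
  rw [starEq, hg.star_eq_val, hg.star_eq_val]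
  exact funext_iff.symm

end OneVar

open OneVar in
theorem theorem5p2 (V : OneVar.LsClass.{u})
    (hV : V = @OneVar.FLe ∨ V = @OneVar.FLew ∨ V = @OneVar.FLec) :
    (∀ (A : Type u) [OneVar.MLsLattice A], V A → OneVar.IsFunctional A) ∧
    (∀ (T : Set (OneVar.FOFm × OneVar.FOFm)) (φ ψ : OneVar.FOFm),
      OneVar.FOConsequence V T (φ, ψ) ↔
        OneVar.ModConsequence V (OneVar.starEq '' T) (φ.star, ψ.star)) := by
  refine ⟨fun A _ hA => ?_, fun T φ ψ => ⟨fun H A _ hA g hg hT => ?_,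
    fun H B _ hB S _ I hT => ?_⟩⟩
  · obtain ⟨B, hc, W, h, -, -, hi, hh⟩ := exists_representation hV A hA
    exact ⟨B, hc, W, h, hi, hh⟩
  · obtain ⟨B, hc, W, h, hB, hW, hi, hh⟩ := exists_representation hV A hA
    have he := hh.comp_isEvaluation hg
    refine hi ((he.foValid_iff (φ, ψ)).1 (H B hB W _ fun δ hδ => (he.foValid_iff δ).2 ?_))
    exact congrArg h (hT _ ⟨δ, hδ, rfl⟩)
  · have he := ModFm.isEvaluation_eval (A := FullFunctional S B) I
    refine (he.foValid_iff (φ, ψ)).2 (H _ (fullFunctional_mem hV S B hB) _ he ?_)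
    rintro _ ⟨δ, hδ, rfl⟩
    exact (he.foValid_iff δ).1 (hT δ hδ)
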